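/- Let $n\ge 0$ and let $F\subset\mathbb R^n$ be a nonempty Motzkin set, that is, $F=K+D$ with $K\subset\mathbb R^n$ compact (not necessarily convex) and $D\subset\mathbb R^n$ a closed convex cone. Then $D=0^+F$, where $0^+F=\{u\in\mathbb R^n : x+tu\in F \text{ for all } x\in F \text{ and all } t\ge 0\}$ is the recession cone of $F$, and the following are equivalent: 1. $F$ is a Frank-and-Wolfe set, that is, every quadratic function $f(x)=\frac12 x^{\mathsf T}Ax+b^{\mathsf T}x+c$ (with $A=A^{\mathsf T}\in\mathbb R^{n\times n}$, $b\in\mathbb R^n$, $c\in\mathbb R$) which is bounded below on $F$ attains its infimum over $F$ at a point of $F$. 2. The recession cone $0^+F$ is polyhedral, that is, it is the solution set of a finite system of homogeneous linear inequalities $a_i^{\mathsf T}u\le 0$. 3. $F$ has no flat asymptotes, that is, there is no affine subspace $M$ of $\mathbb R^n$ with $F\cap M=\emptyset$ and $\mathrm{dist}(F,M)=\inf\{\|x-y\| : x\in F,\ y\in M\}=0$, where $\|\cdot\|$ is the Euclidean norm. -/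

import Mathlib

open scoped Pointwise ENNReal Matrix

/-- A quadratic function on `ℝⁿ`: `f x = ½ xᵀ A x + bᵀ x + c` with `A` a symmetric real matrix. -/
def IsQuadratic {n : ℕ} (f : EuclideanSpace ℝ (Fin n) → ℝ) : Prop :=
  ∃ (A : Matrix (Fin n) (Fin n) ℝ) (b : Fin n → ℝ) (c : ℝ), A.IsSymm ∧
    ∀ x : EuclideanSpace ℝ (Fin n), f x = 1 / 2 * (x.ofLp ⬝ᵥ (A *ᵥ x.ofLp)) + b ⬝ᵥ x.ofLp + c

/-- A Frank-and-Wolfe set: every quadratic function that is bounded below on `F` attains its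
infimum over `F` at a point of `F`. -/
def IsFrankWolfeSet {n : ℕ} (F : Set (EuclideanSpace ℝ (Fin n))) : Prop :=
  ∀ f : EuclideanSpace ℝ (Fin n) → ℝ, IsQuadratic f → BddBelow (f '' F) →
    ∃ x ∈ F, IsMinOn f F x

/-- The Euclidean distance of two sets, `inf {‖x - y‖ : x ∈ S, y ∈ T}`, with values in `[0, ∞]`, so
that the infimum over the empty set is `∞`. -/
noncomputable def setEDist {n : ℕ} (S T : Set (EuclideanSpace ℝ (Fin n))) : ℝ≥0∞ :=
  ⨅ x ∈ S, ⨅ y ∈ T, edist x y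

/-- The affine subspace `M` is a flat asymptote of `F`: `F ∩ M = ∅` and `dist(F, M) = 0`.
(The empty affine subspace `⊥` never is one, as its distance to `F` is `∞`.) -/
def IsFlatAsymptote {n : ℕ} (M : AffineSubspace ℝ (EuclideanSpace ℝ (Fin n)))
    (F : Set (EuclideanSpace ℝ (Fin n))) : Prop :=
  F ∩ (M : Set (EuclideanSpace ℝ (Fin n))) = ∅ ∧
    setEDist F (M : Set (EuclideanSpace ℝ (Fin n))) = 0

/-- The recession cone `0⁺F` of a (not necessarily convex) set `F`. -/
def recessionCone {n : ℕ} (F : Set (EuclideanSpace ℝ (Fin n))) :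
    Set (EuclideanSpace ℝ (Fin n)) :=
  {u | ∀ x ∈ F, ∀ t : ℝ, 0 ≤ t → x + t • u ∈ F}

/-- A polyhedral convex cone: the solution set of a finite system of homogeneous linear
inequalities `⟪a, u⟫ ≤ 0`. -/
def IsPolyhedralCone {n : ℕ} (C : Set (EuclideanSpace ℝ (Fin n))) : Prop :=
  ∃ s : Finset (EuclideanSpace ℝ (Fin n)), C = {u | ∀ a ∈ s, inner ℝ a u ≤ 0}

/-!
Let `F = K + D` with `K` compact and `D` a closed convex cone.

*Polyhedral recession cone implies attainment* (`exists_isMinOn_add_polyhedral`). Along a minimizing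
sequence replace each point by a point of minimal norm in its sublevel set. If these points were
unbounded, their directions would accumulate at a unit vector `u ∈ D` on which the quadratic part
vanishes and along which the function does not decrease. Each inequality defining `D` is either
tight at `u`, or has slack tending to infinity along the sequence, so `u` can be subtracted without
leaving `F`: this shortens the point and does not increase the value, contradicting minimality.

*Attainment implies no flat asymptotes* (`IsFrankWolfeSet.not_isFlatAsymptote`). The squared
distance to a flat asymptote is a quadratic function with infimum zero on `F` that is not attained.

*No flat asymptotes implies a polyhedral recession cone.* If `u` lies in the closure of `D + L` for
a subspace `L`, then for `k ∈ K` the flat `k + u + L` is at distance zero from `F`, so it meets `F`;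
that is, `K + u ⊆ K + (D + L)`. By compactness of `K` this forces `u ∈ D + L`
(`PointedCone.mem_of_forall_add_mem`), so all the sums `D + L` are closed. By a theorem of Mirkil
and Klee (`PointedCone.exists_finset_of_isClosed_sup`) such a cone is polyhedral: by induction its
tangent cones `D + ℝ d` are polyhedral, `D` coincides with `D + ℝ d` near `d`, and by compactness of
the unit sphere finitely many of these local descriptions suffice. The local coincidence needs a
bound that is uniform over the tangent cone, which comes from the finite generation of polyhedral
cones (`PointedCone.DualFG.fg`).
-/

open Filter Topology

/-! ### Finite generation of polyhedral cones -/

/-- Fourier–Motzkin elimination in terms of generators: cutting a finitely generated cone with a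
half-space leaves it finitely generated. -/
theorem PointedCone.fg_inf_comap_positive {V : Type*} [AddCommGroup V] [Module ℝ V]
    {C : PointedCone ℝ V} (hC : C.FG) (φ : V →ₗ[ℝ] ℝ) :
    (C ⊓ (PointedCone.positive ℝ ℝ).comap φ).FG := by
  classical
  obtain ⟨G, rfl⟩ := hC
  let P := G.filter fun g => 0 ≤ φ g
  let N := G.filter fun g => φ g < 0
  let H : Finset V := P ∪ (P ×ˢ N).image fun gh => (-φ gh.2) • gh.1 + φ gh.1 • gh.2
  refine ⟨H, le_antisymm ?_ ?_⟩
  · rw [Submodule.span_le]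
    intro x hx
    simp only [H, P, N, Finset.coe_union, Finset.coe_image, Set.mem_union, Finset.mem_coe,
      Finset.mem_filter, Set.mem_image, Finset.mem_product] at hx
    rcases hx with ⟨hx, hx0⟩ | ⟨⟨g, h⟩, ⟨⟨hg, hg0⟩, hh, hh0⟩, rfl⟩
    · exact ⟨Submodule.subset_span hx, by simpa using hx0⟩
    · refine ⟨?_, ?_⟩
      · exact add_mem (PointedCone.smul_mem _ (by simpa using hh0.le) (Submodule.subset_span hg))
          (PointedCone.smul_mem _ hg0 (Submodule.subset_span hh))
      · simp only [SetLike.mem_coe, PointedCone.mem_comap, PointedCone.mem_positive, map_add,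
          map_smul, smul_eq_mul]
        exact le_of_eq (by ring)
  · rintro x ⟨hx, hx0⟩
    have hG : (G : Set V) = (P : Set V) ∪ N := by
      ext g; simp only [P, N, Finset.coe_filter, Set.mem_union, Set.mem_ofPred_eq]
      constructor
      · intro hg; rcases le_or_gt 0 (φ g) with h | h
        · exact Or.inl ⟨hg, h⟩
        · exact Or.inr ⟨hg, h⟩
      · rintro (h | h) <;> exact h.1
    rw [hG, SetLike.mem_coe, Submodule.span_union, Submodule.mem_sup] at hx
    obtain ⟨p, hp, m, hm, rfl⟩ := hx
    have hPH : Submodule.span _ (P : Set V) ≤ PointedCone.hull ℝ (H : Set V) :=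
      Submodule.span_mono (by simp [H])
    -- The combinations cancelling `φ` stay in the new cone, since this holds on generators.
    have hcomb : ∀ p ∈ PointedCone.hull ℝ (P : Set V), ∀ m ∈ PointedCone.hull ℝ (N : Set V),
        (-φ m) • p + φ p • m ∈ PointedCone.hull ℝ (H : Set V) := by
      intro p hp m hm
      induction hp, hm using Submodule.span_induction₂ with
      | mem_mem g h hg hh =>
        refine Submodule.subset_span ?_
        simp only [H, Finset.coe_union, Finset.coe_image, Set.mem_union, Set.mem_image]
        exact Or.inr ⟨(g, h), by simpa using ⟨hg, hh⟩, rfl⟩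
      | zero_left y hy => simp
      | zero_right x hx => simp
      | add_left x y z _ _ _ h1 h2 =>
        convert add_mem h1 h2 using 1
        simp only [map_add]; module
      | add_right x y z _ _ _ h1 h2 =>
        convert add_mem h1 h2 using 1
        simp only [map_add]; module
      | smul_left r x y _ _ h =>
        convert Submodule.smul_mem _ r h using 1
        obtain ⟨r, hr⟩ := r
        simp only [Nonneg.mk_smul, map_smul, smul_eq_mul]
        module
      | smul_right r x y _ _ h =>
        convert Submodule.smul_mem _ r h using 1
        obtain ⟨r, hr⟩ := r
        simp only [Nonneg.mk_smul, map_smul, smul_eq_mul]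
        module
    have hm0 : m = 0 ∨ φ m < 0 := by
      clear hx0 hp
      induction hm using Submodule.span_induction with
      | mem x hx => right; simpa using (Finset.mem_filter.1 hx).2
      | zero => left; rfl
      | add x y _ _ hx hy =>
        rcases hx with rfl | hx
        · simpa using hy
        · right
          rcases hy with rfl | hy
          · simpa using hx
          · simpa using add_neg hx hy
      | smul r x _ hx =>
        obtain ⟨r, hr⟩ := r
        rcases hx with rfl | hx
        · left; simp
        · rcases hr.eq_or_lt with rfl | hr
          · left; simp [Nonneg.mk_smul]
          · right
            simpa [Nonneg.mk_smul] using mul_neg_of_pos_of_neg hr hx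
    rcases hm0 with rfl | hm0
    · simpa using hPH hp
    · have hx0' : 0 ≤ φ p + φ m := by simpa using hx0
      have hp0 : 0 < φ p := by linarith
      have h1 := PointedCone.smul_mem _ (inv_nonneg.2 hp0.le) (hcomb p hp m hm)
      have h2 := PointedCone.smul_mem _ (mul_nonneg (inv_nonneg.2 hp0.le) hx0') (hPH hp)
      convert add_mem h1 h2 using 1
      match_scalars
      · field_simp
        ring
      · field_simp

/-- The half of the Minkowski–Weyl theorem that produces generators from inequalities. -/
theorem PointedCone.DualFG.fg {V W : Type*} [AddCommGroup V] [Module ℝ V]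
    [AddCommGroup W] [Module ℝ W] [FiniteDimensional ℝ V] {p : W →ₗ[ℝ] V →ₗ[ℝ] ℝ}
    {C : PointedCone ℝ V} (hC : C.DualFG p) : C.FG := by
  classical
  obtain ⟨s, rfl⟩ := hC
  induction s using Finset.induction_on with
  | empty => simpa using (Module.Finite.fg_top : (⊤ : PointedCone ℝ V).FG)
  | insert a s _ ih =>
    rw [Finset.coe_insert, PointedCone.dual_insert, PointedCone.dual_singleton, inf_comm]
    exact PointedCone.fg_inf_comap_positive ih _

/-! ### Recession cones of Motzkin sets -/

theorem recessionCone_add_eq {n : ℕ} {K : Set (EuclideanSpace ℝ (Fin n))}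
    {D : PointedCone ℝ (EuclideanSpace ℝ (Fin n))} (hK : IsCompact K) (hKne : K.Nonempty)
    (hD : IsClosed (D : Set (EuclideanSpace ℝ (Fin n)))) :
    recessionCone (K + (D : Set (EuclideanSpace ℝ (Fin n)))) = D := by
  ext u
  constructor
  · intro hu
    obtain ⟨x, hx⟩ := hKne
    have hx' : x ∈ K + (D : Set (EuclideanSpace ℝ (Fin n))) := ⟨x, hx, 0, D.zero_mem, by simp⟩
    have h : ∀ m : ℕ, ∃ k ∈ K, ∃ d ∈ D, k + d = x + ((m : ℝ) + 1) • u := fun m =>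
      hu x hx' ((m : ℝ) + 1) (by positivity)
    choose k hk d hd hkd using h
    -- `d m / (m + 1)` differs from `u` by `(x - k m) / (m + 1)`, which tends to zero.
    have hlim : Tendsto (fun m : ℕ => ((m : ℝ) + 1)⁻¹ • d m) atTop (𝓝 u) := by
      have h0 : Tendsto (fun m : ℕ => ((m : ℝ) + 1)⁻¹ • (x - k m)) atTop (𝓝 0) := by
        obtain ⟨R, hR⟩ := hK.isBounded.exists_norm_le
        have h1 : Tendsto (fun m : ℕ => ((m : ℝ) + 1)⁻¹) atTop (𝓝 0) := by
          simpa only [one_div] using tendsto_one_div_add_atTop_nhds_zero_nat (𝕜 := ℝ)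
        refine NormedField.tendsto_zero_smul_of_tendsto_zero_of_bounded h1 ?_
        refine isBoundedUnder_of ⟨‖x‖ + R, fun m => ?_⟩
        exact (norm_sub_le _ _).trans (by gcongr; exact hR _ (hk m))
      have h2 := (tendsto_const_nhds (x := u)).add h0
      rw [add_zero] at h2
      refine h2.congr fun m => ?_
      have hm : ((m : ℝ) + 1) ≠ 0 := by positivity
      have : d m = x - k m + ((m : ℝ) + 1) • u := by
        rw [← sub_eq_zero, ← sub_eq_zero.2 (hkd m)]; abel
      rw [this, smul_add, smul_smul, inv_mul_cancel₀ hm, one_smul, add_comm]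
    exact hD.mem_of_tendsto hlim (Eventually.of_forall fun m =>
      D.smul_mem (by positivity) (hd m))
  · rintro hu _ ⟨k, hk, d, hd, rfl⟩ t ht
    exact ⟨k, hk, d + t • u, add_mem hd (D.smul_mem ht hu), by simp [add_assoc]⟩

/-! ### Quadratic functions on sets with polyhedral recession cone -/

/-- A Frank–Wolfe theorem for sets `K + D` with `K` compact and `D` a polyhedral cone. The function
`f` is quadratic in the sense that its restriction to each line is given by `m` and `q`.

Among the points of a sublevel set choose one of minimal norm. If such points `x k` were unbounded
along a minimizing sequence, their directions would accumulate at some `u ∈ D` along which `f` does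
not decrease; polyhedrality makes `x k - u` a point of the set, of smaller norm and no larger
value. -/
theorem exists_isMinOn_add_polyhedral {E : Type*} [NormedAddCommGroup E] [InnerProductSpace ℝ E]
    [FiniteDimensional ℝ E] {K D : Set E} (hK : IsCompact K) (hKne : K.Nonempty)
    (s : Finset E) (hD : D = {u | ∀ a ∈ s, inner ℝ a u ≤ 0})
    {f q : E → ℝ} {m : E → E → ℝ} (hfc : Continuous f) (hqc : Continuous q)
    (hmc : Continuous (m 0)) (hf : ∀ x u t, f (x + t • u) = f x + t * m x u + t ^ 2 * q u)
    (hbdd : BddBelow (f '' (K + D))) : ∃ x ∈ K + D, IsMinOn f (K + D) x := by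
  have hDc : IsClosed D := by
    have : D = ⋂ a ∈ s, {u | inner ℝ a u ≤ 0} := by rw [hD]; ext; simp
    rw [this]
    exact isClosed_biInter fun a _ => isClosed_le (by fun_prop) continuous_const
  have hFc : IsClosed (K + D) := hDc.add_left_of_isCompact hK
  have hFne : (K + D).Nonempty := hKne.add ⟨0, by simp [hD]⟩
  have hDadd : ∀ x ∈ K + D, ∀ u ∈ D, x + u ∈ K + D := by
    rintro _ ⟨y, hy, z, hz, rfl⟩ u hu
    refine ⟨y, hy, z + u, ?_, by simp [add_assoc]⟩
    rw [hD] at hz hu ⊢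
    intro a ha
    rw [inner_add_right]
    exact add_nonpos (hz a ha) (hu a ha)
  set γ := sInf (f '' (K + D)) with hγ
  have hγle : ∀ x ∈ K + D, γ ≤ f x := fun x hx => csInf_le hbdd ⟨x, hx, rfl⟩
  obtain ⟨v, -, hv, hvF⟩ := exists_seq_tendsto_sInf (hFne.image f) hbdd
  choose w hwF hwv using hvF
  have hmin : ∀ k, ∃ x ∈ K + D, f x ≤ v k ∧ ∀ y ∈ K + D, f y ≤ v k → ‖x‖ ≤ ‖y‖ := by
    intro k
    have hcl : IsClosed ((K + D) ∩ {x | f x ≤ v k}) :=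
      hFc.inter (isClosed_le hfc continuous_const)
    obtain ⟨x, hx, hxd⟩ := hcl.exists_infDist_eq_dist ⟨w k, hwF k, (hwv k).le⟩ 0
    refine ⟨x, hx.1, hx.2, fun y hy hyv => ?_⟩
    have := Metric.infDist_le_dist_of_mem (x := 0)
      (show y ∈ (K + D) ∩ {x | f x ≤ v k} from ⟨hy, hyv⟩)
    rwa [hxd, dist_zero_left, dist_zero_left] at this
  choose x hxF hxv hxmin using hmin
  have hfx : Tendsto (fun k => f (x k)) atTop (𝓝 γ) :=
    tendsto_of_tendsto_of_tendsto_of_le_of_le tendsto_const_nhds hv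
      (fun k => hγle _ (hxF k)) hxv
  by_cases hfreq : ∃ R, ∃ᶠ k in atTop, ‖x k‖ ≤ R
  · obtain ⟨R, hR⟩ := hfreq
    obtain ⟨a, -, φ, hφ, ha⟩ := tendsto_subseq_of_frequently_bounded
      (Metric.isBounded_closedBall (x := (0 : E)) (r := R)) (x := x)
      (hR.mono fun k hk => by simpa using hk)
    have haF : a ∈ K + D := hFc.mem_of_tendsto ha (Eventually.of_forall fun k => hxF _)
    have hfa : f a = γ := tendsto_nhds_unique ((hfc.tendsto a).comp ha)
      (hfx.comp hφ.tendsto_atTop)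
    exact ⟨a, haF, fun y hy => by simpa [hfa] using hγle y hy⟩
  exfalso
  simp only [not_exists, not_frequently, not_le] at hfreq
  have hnorm : Tendsto (fun k => ‖x k‖) atTop atTop :=
    tendsto_atTop.2 fun R => (hfreq R).mono fun k hk => hk.le
  obtain ⟨u, hu, φ, hφ, hφu⟩ := (isCompact_closedBall (0 : E) 1).tendsto_subseq
    (x := fun k => ‖x k‖⁻¹ • x k) (fun k => by
      simp only [mem_closedBall_zero_iff, norm_smul, norm_inv, norm_norm]
      exact inv_mul_le_one)
  have hr : Tendsto (fun k => ‖x (φ k)‖) atTop atTop := hnorm.comp hφ.tendsto_atTop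
  have hri : Tendsto (fun k => ‖x (φ k)‖⁻¹) atTop (𝓝 0) := tendsto_inv_atTop_zero.comp hr
  have hrpos : ∀ᶠ k in atTop, 0 < ‖x (φ k)‖ := hr.eventually_gt_atTop 0
  have hxsm : ∀ k, 0 < ‖x (φ k)‖ → ‖x (φ k)‖ • (‖x (φ k)‖⁻¹ • x (φ k)) = x (φ k) := fun k hk => by
    rw [smul_smul, mul_inv_cancel₀ hk.ne', one_smul]
  have hu1 : ‖u‖ = 1 := by
    refine tendsto_nhds_unique hφu.norm ?_
    refine tendsto_const_nhds.congr' (hrpos.mono fun k hk => ?_)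
    simp [norm_smul, hk.ne']
  obtain ⟨R, hR⟩ := hK.isBounded.exists_norm_le
  have hdec : ∀ k, ∃ y ∈ K, ∃ z ∈ D, y + z = x (φ k) := fun k => hxF (φ k)
  choose y hy z hz hyz using hdec
  have hyb : ∀ a k, |inner ℝ a (y k)| ≤ ‖a‖ * R := fun a k =>
    (abs_real_inner_le_norm _ _).trans (by gcongr; exact hR _ (hy k))
  have hinner : ∀ a, Tendsto (fun k => inner ℝ a (‖x (φ k)‖⁻¹ • x (φ k))) atTop
      (𝓝 (inner ℝ a u)) := fun a => (tendsto_const_nhds (x := a)).inner hφu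
  have huD : u ∈ D := by
    rw [hD]
    intro a ha
    have h0 : Tendsto (fun k => ‖x (φ k)‖⁻¹ * (‖a‖ * R)) atTop (𝓝 0) := by
      simpa using hri.mul_const (‖a‖ * R)
    refine le_of_tendsto_of_tendsto (hinner a) h0 (Eventually.of_forall fun k => ?_)
    have hzk : inner ℝ a (z k) ≤ 0 := by have := hz k; rw [hD] at this; exact this a ha
    simp only [inner_smul_right]
    gcongr
    rw [← hyz k, inner_add_right]
    linarith [le_abs_self (inner ℝ a (y k)), hyb a k]
  have hqu : q u = 0 := by
    refine tendsto_nhds_unique ((hqc.tendsto u).comp hφu) ?_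
    have h1 : Tendsto (fun k => (f (x (φ k)) - f 0) * (‖x (φ k)‖⁻¹ * ‖x (φ k)‖⁻¹)
        - ‖x (φ k)‖⁻¹ * m 0 (‖x (φ k)‖⁻¹ • x (φ k))) atTop (𝓝 ((γ - f 0) * (0 * 0) - 0 * m 0 u)) :=
      (((hfx.comp hφ.tendsto_atTop).sub tendsto_const_nhds).mul (hri.mul hri)).sub
        (hri.mul ((hmc.tendsto u).comp hφu))
    rw [show (γ - f 0) * (0 * 0) - 0 * m 0 u = 0 by ring] at h1
    refine h1.congr' (hrpos.mono fun k hk => ?_)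
    have h2 := hf 0 (‖x (φ k)‖⁻¹ • x (φ k)) ‖x (φ k)‖
    rw [zero_add, hxsm k hk] at h2
    simp only [Function.comp_apply]
    rw [h2]
    field_simp
    ring
  have hmu : ∀ x ∈ K + D, 0 ≤ m x u := by
    intro x hx
    by_contra! hneg
    set t := (γ - f x - 1) / m x u with ht
    have htpos : 0 ≤ t := div_nonneg_of_nonpos (by linarith [hγle x hx]) hneg.le
    have h1 := hγle _ (hDadd x hx (t • u) (by
      rw [hD] at huD ⊢
      intro a ha
      rw [inner_smul_right]
      exact mul_nonpos_of_nonneg_of_nonpos htpos (huD a ha)))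
    rw [hf, hqu, ht, div_mul_cancel₀ _ hneg.ne] at h1
    linarith
  have hsub : ∀ᶠ k in atTop, z k - u ∈ D := by
    have : ∀ a ∈ s, ∀ᶠ k in atTop, inner ℝ a (z k - u) ≤ 0 := by
      intro a ha
      have huD' : inner ℝ a u ≤ 0 := by rw [hD] at huD; exact huD a ha
      rcases huD'.eq_or_lt with h0 | hlt
      · refine Eventually.of_forall fun k => ?_
        have hzk : inner ℝ a (z k) ≤ 0 := by have := hz k; rw [hD] at this; exact this a ha
        rw [inner_sub_right, h0, sub_zero]
        exact hzk
      · have h1 := hr.atTop_mul_neg hlt (hinner a)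
        filter_upwards [h1.eventually_le_atBot (inner ℝ a u - ‖a‖ * R), hrpos] with k hk hk0
        rw [← inner_smul_right, hxsm k hk0, ← hyz k, inner_add_right] at hk
        rw [inner_sub_right]
        linarith [neg_le_of_abs_le (hyb a k)]
    rw [hD]
    exact (eventually_all_finset s).2 this
  have hxu : Tendsto (fun k => inner ℝ (x (φ k)) u) atTop atTop := by
    have h1 : Tendsto (fun k => inner ℝ (‖x (φ k)‖⁻¹ • x (φ k)) u) atTop (𝓝 (inner ℝ u u)) :=
      hφu.inner tendsto_const_nhds
    rw [real_inner_self_eq_norm_sq, hu1, one_pow] at h1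
    refine (hr.atTop_mul_pos one_pos h1).congr' (hrpos.mono fun k hk => ?_)
    rw [← real_inner_smul_left, hxsm k hk]
  obtain ⟨k, hk1, hk2⟩ := (hsub.and (hxu.eventually_gt_atTop (1 / 2))).exists
  have hmem : x (φ k) - u ∈ K + D := ⟨y k, hy k, z k - u, hk1, by rw [← hyz k]; simp [add_sub_assoc]⟩
  have hval : f (x (φ k) - u) ≤ v (φ k) := by
    have h1 := hf (x (φ k)) u (-1)
    rw [hqu, neg_one_smul, ← sub_eq_add_neg] at h1
    linarith [hmu _ (hxF (φ k)), hxv (φ k)]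
  have hle := hxmin _ _ hmem hval
  have hsq : ‖x (φ k) - u‖ ^ 2 = ‖x (φ k)‖ ^ 2 - 2 * inner ℝ (x (φ k)) u + 1 := by
    rw [norm_sub_sq_real, hu1, one_pow]
  nlinarith [norm_nonneg (x (φ k)), norm_nonneg (x (φ k) - u)]

theorem isFrankWolfeSet_add_of_isPolyhedralCone {n : ℕ} {K D : Set (EuclideanSpace ℝ (Fin n))}
    (hK : IsCompact K) (hKne : K.Nonempty) (hD : IsPolyhedralCone D) :
    IsFrankWolfeSet (K + D) := by
  rintro f ⟨A, b, c, hA, hf⟩ hbdd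
  obtain ⟨s, hs⟩ := hD
  obtain rfl : f = _ := funext hf
  refine exists_isMinOn_add_polyhedral hK hKne s hs
    (q := fun u => 1 / 2 * (u.ofLp ⬝ᵥ (A *ᵥ u.ofLp)))
    (m := fun x u => (A *ᵥ x.ofLp + b) ⬝ᵥ u.ofLp) ?_ ?_ ?_ ?_ hbdd
  · fun_prop
  · fun_prop
  · fun_prop
  · intro x u t
    have hsymm : u.ofLp ⬝ᵥ (A *ᵥ x.ofLp) = x.ofLp ⬝ᵥ (A *ᵥ u.ofLp) := by
      rw [Matrix.dotProduct_mulVec, ← Matrix.mulVec_transpose, hA.eq, dotProduct_comm]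
    simp only [WithLp.ofLp_add, WithLp.ofLp_smul, Matrix.mulVec_add, Matrix.mulVec_smul,
      dotProduct_add, add_dotProduct, dotProduct_smul, smul_dotProduct, smul_eq_mul]
    rw [hsymm, dotProduct_comm (A *ᵥ x.ofLp), hsymm]
    ring

/-! ### Flat asymptotes of Frank-and-Wolfe sets -/

theorem isQuadratic_of_isSymmetric {n : ℕ}
    {T : EuclideanSpace ℝ (Fin n) →ₗ[ℝ] EuclideanSpace ℝ (Fin n)} (hT : T.IsSymmetric)
    (b : EuclideanSpace ℝ (Fin n)) (c : ℝ) :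
    IsQuadratic fun x => 1 / 2 * inner ℝ x (T x) + inner ℝ b x + c := by
  obtain ⟨A, rfl⟩ := Matrix.toEuclideanLin.surjective T
  refine ⟨A, b.ofLp, c, ?_, fun x => ?_⟩
  · have := Matrix.isSymmetric_toEuclideanLin_iff.1 hT
    simpa [Matrix.IsHermitian, Matrix.IsSymm, Matrix.conjTranspose_eq_transpose_of_trivial]
      using this
  · simp [EuclideanSpace.inner_eq_star_dotProduct, Matrix.toLpLin_apply, dotProduct_comm]

theorem IsFrankWolfeSet.not_isFlatAsymptote {n : ℕ} {F : Set (EuclideanSpace ℝ (Fin n))}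
    (hF : IsFrankWolfeSet F) (M : AffineSubspace ℝ (EuclideanSpace ℝ (Fin n))) :
    ¬ IsFlatAsymptote M F := by
  rintro ⟨hdisj, hdist⟩
  have hclose : ∀ ε > 0, ∃ x ∈ F, ∃ y ∈ M, dist x y < ε := by
    intro ε hε
    have : setEDist F (M : Set (EuclideanSpace ℝ (Fin n))) < ENNReal.ofReal ε := by
      rw [hdist]; simpa using hε
    simp only [setEDist, iInf_lt_iff] at this
    obtain ⟨x, hx, y, hy, h⟩ := this
    exact ⟨x, hx, y, hy, by rwa [edist_dist, ENNReal.ofReal_lt_ofReal_iff hε] at h⟩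
  obtain ⟨-, -, p, hp, -⟩ := hclose 1 one_pos
  let P := M.directionᗮ.starProjection
  have hPsymm : ∀ x y, inner ℝ (P x) y = inner ℝ x (P y) := fun x y =>
    Submodule.inner_starProjection_left_eq_right _ x y
  have hPP : ∀ x, inner ℝ x (P x) = ‖P x‖ ^ 2 := fun x => by
    rw [← real_inner_self_eq_norm_sq, hPsymm]
    congr 1
    exact (Submodule.starProjection_eq_self_iff.2 (Submodule.starProjection_apply_mem _ x)).symm
  have hzero : ∀ x, P x = 0 ↔ x ∈ M.direction := fun x => by
    rw [Submodule.starProjection_apply_eq_zero_iff, Submodule.orthogonal_orthogonal]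
  -- the squared distance to `M`
  have hquad : IsQuadratic fun x => ‖P (x - p)‖ ^ 2 := by
    have := isQuadratic_of_isSymmetric (T := (2 : ℝ) • (P : _ →ₗ[ℝ] _))
      (fun x y => by
        simp only [LinearMap.smul_apply, ContinuousLinearMap.coe_coe, inner_smul_left,
          inner_smul_right, hPsymm]
        rfl)
      (-(2 : ℝ) • P p) (‖P p‖ ^ 2)
    convert this using 2 with x
    have hcross : inner ℝ (P x) (P p) = inner ℝ (P p) x := by
      rw [real_inner_comm, hPsymm,
        Submodule.starProjection_eq_self_iff.2 (Submodule.starProjection_apply_mem _ x), hPsymm]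
    rw [map_sub, norm_sub_sq_real, ← hPP x, hcross]
    simp only [LinearMap.smul_apply, ContinuousLinearMap.coe_coe, real_inner_smul_left,
      real_inner_smul_right]
    ring
  obtain ⟨x, hx, hmin⟩ := hF _ hquad ⟨0, by rintro _ ⟨x, -, rfl⟩; positivity⟩
  have hx0 : P (x - p) = 0 := by
    by_contra hne
    obtain ⟨x', hx', y, hy, hlt⟩ := hclose ‖P (x - p)‖ (norm_pos_iff.2 hne)
    have h1 : ‖P (x - p)‖ ^ 2 ≤ ‖P (x' - p)‖ ^ 2 := hmin hx'
    have h2 : P (x' - p) = P (x' - y) := by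
      rw [← sub_eq_zero, ← map_sub, hzero]
      simpa using M.vsub_mem_direction hy hp
    have h3 : ‖P (x' - p)‖ < ‖P (x - p)‖ := by
      rw [h2]
      refine (Submodule.norm_starProjection_apply_le _ _).trans_lt ?_
      rwa [← dist_eq_norm]
    exact absurd h1 (not_le.2 (by gcongr))
  have : x ∈ F ∩ (M : Set (EuclideanSpace ℝ (Fin n))) :=
    ⟨hx, (M.vsub_right_mem_direction_iff_mem hp x).1 ((hzero _).1 hx0)⟩
  rw [hdisj] at this
  exact this

/-! ### Sets without flat asymptotes have closed sums with subspaces -/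

section Separation

variable {E : Type*} [NormedAddCommGroup E] [InnerProductSpace ℝ E] [FiniteDimensional ℝ E]

/-- A convex cone `Q`, not necessarily closed, is properly separated from a point outside it. -/
theorem PointedCone.exists_separation_of_notMem (Q : PointedCone ℝ E) {u : E} (hu : u ∉ Q) :
    ∃ φ : E →L[ℝ] ℝ, (∀ q ∈ Q, 0 ≤ φ q) ∧ φ u ≤ 0 ∧ (φ u < 0 ∨ ∃ q ∈ Q, φ q ≠ 0) := by
  set W := Submodule.span ℝ (Q : Set E) with hW
  by_cases huW : u ∈ W
  · set Q' : PointedCone ℝ W := Q.comap W.subtype with hQ'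
    have hspan : Submodule.span ℝ (Q' : Set W) = ⊤ := by
      have : (Q' : Set W) = ((↑) : W → E) ⁻¹' (Q : Set E) := rfl
      rw [this, Submodule.span_span_coe_preimage]
    have hint : (interior (Q' : Set W)).Nonempty := by
      rw [Q'.convex.interior_nonempty_iff_affineSpan_eq_top,
        AffineSubspace.affineSpan_eq_top_iff_vectorSpan_eq_top_of_nonempty ℝ W W
          ⟨0, Q'.zero_mem⟩,
        vectorSpan_eq_span_vsub_set_right ℝ (show (0 : W) ∈ (Q' : Set W) from Q'.zero_mem)]
      simpa using hspan
    obtain ⟨ψ, hψ, hle⟩ := geometric_hahn_banach_of_nonempty_interior_point Q'.convex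
      (x := ⟨u, huW⟩) (fun h => hu (interior_subset (s := (Q' : Set W)) h)) hint
    have hle0 : ∀ q ∈ Q', ψ q ≤ 0 := by
      intro q hq
      by_contra! hpos
      set t := (|ψ ⟨u, huW⟩| + 1) / ψ q
      have h1 := hle (t • q) (Q'.smul_mem (by positivity) hq)
      rw [map_smul, smul_eq_mul, div_mul_cancel₀ _ hpos.ne'] at h1
      linarith [le_abs_self (ψ ⟨u, huW⟩)]
    obtain ⟨Φ, hΦ⟩ := LinearMap.exists_extend (p := W) (-(ψ : W →ₗ[ℝ] ℝ))
    have hΦ' : ∀ w : W, Φ w = -ψ w := fun w => congrArg (· w) hΦ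
    refine ⟨Φ.toContinuousLinearMap, fun q hq => ?_, ?_, Or.inr ?_⟩
    · have := hle0 ⟨q, Submodule.subset_span hq⟩ hq
      have h2 := hΦ' ⟨q, Submodule.subset_span hq⟩
      simp only [LinearMap.coe_toContinuousLinearMap'] at h2 ⊢
      linarith
    · have := hle 0 Q'.zero_mem
      have h2 := hΦ' ⟨u, huW⟩
      rw [map_zero] at this
      simp only [LinearMap.coe_toContinuousLinearMap'] at h2 ⊢
      linarith
    · by_contra! h
      apply hψ
      ext w
      have hker : W ≤ LinearMap.ker Φ := Submodule.span_le.2 fun q hq => h q hq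
      have := hker w.2
      rw [LinearMap.mem_ker, hΦ' w] at this
      simpa using this
  · obtain ⟨Φ, hΦu, hΦW⟩ := Submodule.exists_le_ker_of_notMem huW
    have hQ : ∀ q ∈ Q, Φ q = 0 := fun q hq => hΦW (Submodule.subset_span hq)
    refine ⟨(-(Φ u) • Φ).toContinuousLinearMap, fun q hq => by simp [hQ q hq], ?_, Or.inl ?_⟩
    · simpa using mul_self_nonneg (Φ u)
    · simpa using mul_self_pos.2 hΦu

/-- If `K + u ⊆ K + Q` for a nonempty compact set `K` and a convex cone `Q`, which need not be
closed, then `u ∈ Q`. A functional separating `u` from `Q` reduces the claim to the face of `K` on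
which it is minimal and to the part of `Q` in its kernel, which has smaller dimension. -/
theorem PointedCone.mem_of_forall_add_mem (Q : PointedCone ℝ E) {u : E} {K : Set E}
    (hK : IsCompact K) (hKne : K.Nonempty) (h : ∀ k ∈ K, k + u ∈ K + (Q : Set E)) : u ∈ Q := by
  induction hd : Module.finrank ℝ (Submodule.span ℝ (Q : Set E)) using Nat.strong_induction_on
    generalizing Q K with
  | _ d ih =>
  by_contra hu
  obtain ⟨φ, hφQ, hφu, hφ⟩ := Q.exists_separation_of_notMem hu
  obtain ⟨k₀, hk₀, hmin⟩ := hK.exists_isMinOn hKne φ.continuous.continuousOn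
  have hmin' : ∀ k ∈ K, φ k₀ ≤ φ k := fun k hk => hmin hk
  rcases hφ with hlt | ⟨q, hq, hφq⟩
  · obtain ⟨k₁, hk₁, q, hq, hkq⟩ := h k₀ hk₀
    have h1 : φ k₁ + φ q = φ k₀ + φ u := by rw [← map_add, ← map_add]; exact congrArg φ hkq
    linarith [hmin' k₁ hk₁, hφQ q hq]
  · set Q' : PointedCone ℝ E := Q ⊓ PointedCone.ofSubmodule (LinearMap.ker (φ : E →ₗ[ℝ] ℝ)) with hQ'
    have hspan : Submodule.span ℝ (Q' : Set E) < Submodule.span ℝ (Q : Set E) := by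
      refine lt_of_le_of_ne (Submodule.span_mono fun x hx => hx.1) fun heq => hφq ?_
      have h1 : q ∈ Submodule.span ℝ (Q' : Set E) := heq ▸ Submodule.subset_span hq
      have h2 : Submodule.span ℝ (Q' : Set E) ≤ LinearMap.ker (φ : E →ₗ[ℝ] ℝ) :=
        Submodule.span_le.2 fun x hx => hx.2
      exact h2 h1
    refine hu (ih _ (hd ▸ Submodule.finrank_lt_finrank_of_lt hspan) Q'
      (K := K ∩ {k | φ k ≤ φ k₀}) (hK.inter_right (isClosed_le φ.continuous continuous_const))
      ⟨k₀, hk₀, show φ k₀ ≤ φ k₀ from le_rfl⟩ ?_ rfl).1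
    rintro k ⟨hk, hkk₀⟩
    obtain ⟨k₁, hk₁, q, hq, hkq⟩ := h k hk
    have h1 : φ k₁ + φ q = φ k + φ u := by rw [← map_add, ← map_add]; exact congrArg φ hkq
    have hkk₀' : φ k ≤ φ k₀ := hkk₀
    have h2 := hmin' k₁ hk₁
    have h3 := hφQ q hq
    exact ⟨k₁, ⟨hk₁, show φ k₁ ≤ φ k₀ by linarith⟩, q, ⟨hq, show φ q = 0 by linarith⟩, hkq⟩

end Separation

theorem isClosed_sup_of_not_isFlatAsymptote {n : ℕ} {K : Set (EuclideanSpace ℝ (Fin n))}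
    {D : PointedCone ℝ (EuclideanSpace ℝ (Fin n))} (hK : IsCompact K) (hKne : K.Nonempty)
    (h : ∀ M : AffineSubspace ℝ (EuclideanSpace ℝ (Fin n)),
      ¬ IsFlatAsymptote M (K + (D : Set (EuclideanSpace ℝ (Fin n)))))
    (L : Submodule ℝ (EuclideanSpace ℝ (Fin n))) :
    IsClosed ((D ⊔ (L : PointedCone ℝ _) : PointedCone ℝ _) : Set (EuclideanSpace ℝ (Fin n))) := by
  refine isClosed_of_closure_subset fun u hu => ?_
  refine PointedCone.mem_of_forall_add_mem _ hK hKne fun k hk => ?_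
  by_contra hku
  -- Otherwise the translate of `L` through `k + u` is a flat asymptote.
  refine h (AffineSubspace.mk' (k + u) L) ⟨?_, ?_⟩
  · refine Set.eq_empty_of_forall_notMem ?_
    rintro _ ⟨⟨k', hk', d, hd, rfl⟩, hx⟩
    rw [SetLike.mem_coe, AffineSubspace.mem_mk'] at hx
    refine hku ⟨k', hk', d + -(k' + d -ᵥ (k + u)), ?_, ?_⟩
    · exact Submodule.add_mem_sup hd (L.neg_mem hx)
    · simp only [vsub_eq_sub]; abel
  · refine le_antisymm (ENNReal.le_of_forall_pos_le_add fun ε hε _ => ?_) zero_le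
    obtain ⟨v, hv, huv⟩ := Metric.mem_closure_iff.1 hu ε hε
    obtain ⟨d, hd, l, hl, rfl⟩ := Submodule.mem_sup.1 hv
    have hmem : k + u - l ∈ AffineSubspace.mk' (k + u) L := by
      rw [AffineSubspace.mem_mk']
      simpa using hl
    refine (iInf₂_le_of_le (k + d) ⟨k, hk, d, hd, rfl⟩
      (iInf₂_le_of_le (k + u - l) hmem le_rfl)).trans ?_
    rw [zero_add, edist_nndist, ENNReal.coe_le_coe, ← NNReal.coe_le_coe, coe_nndist,
      dist_comm, dist_eq_norm, show k + u - l - (k + d) = u - (d + l) by abel, ← dist_eq_norm]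
    exact huv.le

/-! ### Cones whose sums with all subspaces are closed are polyhedral -/

section Mirkil

variable {E : Type*} [NormedAddCommGroup E] [InnerProductSpace ℝ E]

/-- The unit vectors of a cone that are orthogonal to its lineality space. -/
def PointedCone.orthogonalUnit (D : PointedCone ℝ E) : Set E :=
  {e | e ∈ D ∧ e ∈ D.linealᗮ ∧ ‖e‖ = 1}

theorem PointedCone.notMem_lineal_of_mem_orthogonalUnit {D : PointedCone ℝ E} {e : E}
    (he : e ∈ D.orthogonalUnit) : e ∉ D.lineal := by
  intro h
  have h0 : inner ℝ e e = 0 := Submodule.inner_right_of_mem_orthogonal h he.2.1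
  have h1 := he.2.2
  rw [inner_self_eq_zero] at h0
  simp [h0] at h1

variable [FiniteDimensional ℝ E]

theorem Submodule.exists_finset_eq_inner_nonpos (L : Submodule ℝ E) :
    ∃ s : Finset E, (L : Set E) = {u | ∀ a ∈ s, inner ℝ a u ≤ 0} := by
  classical
  obtain ⟨s, hs⟩ := (inferInstance : IsNoetherian ℝ E).noetherian Lᗮ
  refine ⟨s ∪ s.image (-·), ?_⟩
  ext u
  have : u ∈ L ↔ ∀ a ∈ s, inner ℝ a u = 0 := by
    constructor
    · intro hu a ha
      exact Submodule.inner_left_of_mem_orthogonal hu (hs ▸ Submodule.subset_span ha)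
    · intro h
      rw [← L.orthogonal_orthogonal, ← hs, Submodule.mem_orthogonal]
      intro v hv
      induction hv using Submodule.span_induction with
      | mem a ha => exact h a ha
      | zero => simp
      | add x y _ _ hx hy => rw [inner_add_left, hx, hy, add_zero]
      | smul r x _ hx => rw [inner_smul_left, hx, mul_zero]
  rw [SetLike.mem_coe, this]
  simp only [Finset.mem_union, Finset.mem_image, Set.mem_ofPred_eq]
  constructor
  · rintro h _ (ha | ⟨a, ha, rfl⟩)
    · exact (h _ ha).le
    · rw [inner_neg_left, h a ha, neg_zero]
  · intro h a ha
    have := h (-a) (Or.inr ⟨a, ha, rfl⟩)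
    rw [inner_neg_left] at this
    linarith [h a (Or.inl ha)]

/-- If every point of a polyhedral cone is moved into `D` by some multiple of `d ∈ D`, then the
multiple can be bounded by the norm of the point. The proof homogenizes: finitely many generators
of the cone of pairs `(x, r)` with `x` in the polyhedral cone and coordinates at most `r` in
absolute value suffice to determine the constant. -/
theorem PointedCone.exists_forall_add_norm_smul_mem {D : PointedCone ℝ E} {d : E} (hd : d ∈ D)
    {s : Finset E} (h : ∀ x, (∀ a ∈ s, inner ℝ a x ≤ 0) → ∃ r : ℝ, x + r • d ∈ D) :
    ∃ C : ℝ, 0 ≤ C ∧ ∀ x, (∀ a ∈ s, inner ℝ a x ≤ 0) → x + (C * ‖x‖) • d ∈ D := by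
  classical
  let b := stdOrthonormalBasis ℝ E
  let fst := LinearMap.fst ℝ E ℝ
  let snd := LinearMap.snd ℝ E ℝ
  let t : Finset (Module.Dual ℝ (E × ℝ)) :=
    insert snd (s.image (fun a => -(innerₗ E a ∘ₗ fst)) ∪
      (Finset.univ.image (fun i => snd - innerₗ E (b i) ∘ₗ fst) ∪
        Finset.univ.image (fun i => snd + innerₗ E (b i) ∘ₗ fst)))
  let P : PointedCone ℝ (E × ℝ) := PointedCone.dual (M := Module.Dual ℝ (E × ℝ)) .id t
  have hP : ∀ p : E × ℝ, p ∈ P ↔ 0 ≤ p.2 ∧ (∀ a ∈ s, inner ℝ a p.1 ≤ 0) ∧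
      ∀ i, |inner ℝ (b i) p.1| ≤ p.2 := by
    intro p
    simp only [P, t, fst, snd, PointedCone.mem_dual, Finset.coe_insert, Finset.coe_union,
      Finset.coe_image, Set.mem_insert_iff, Set.mem_union, Set.mem_image, Finset.mem_coe,
      Finset.mem_univ, true_and, abs_le]
    constructor
    · intro hp
      refine ⟨by simpa using hp (Or.inl rfl), fun a ha => ?_, fun i => ⟨?_, ?_⟩⟩
      · simpa using hp (Or.inr (Or.inl ⟨a, ha, rfl⟩))
      · have := hp (Or.inr (Or.inr (Or.inr ⟨i, rfl⟩)))
        simpa [neg_le_iff_add_nonneg'] using this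
      · have := hp (Or.inr (Or.inr (Or.inl ⟨i, rfl⟩)))
        simpa using this
    · rintro ⟨h1, h2, h3⟩ φ (rfl | ⟨a, ha, rfl⟩ | ⟨i, rfl⟩ | ⟨i, rfl⟩)
      · simpa using h1
      · simpa using h2 a ha
      · simpa using (h3 i).2
      · simpa [neg_le_iff_add_nonneg'] using (h3 i).1
  obtain ⟨G, hG⟩ : P.FG := PointedCone.DualFG.fg ⟨t, rfl⟩
  have hGC : ∀ g ∈ G, ∃ C : ℝ, 0 ≤ C ∧ ∀ C' ≥ C, g.1 + (C' * g.2) • d ∈ D := by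
    intro g hg
    obtain ⟨h1, h2, h3⟩ := (hP g).1 (hG ▸ Submodule.subset_span hg)
    rcases h1.eq_or_lt with h0 | hpos
    · have hg0 : g.1 = 0 := by
        refine InnerProductSpace.ext_inner_left_basis (𝕜 := ℝ) b.toBasis fun i => ?_
        have := h3 i
        rw [← h0] at this
        simpa using this
      exact ⟨0, le_rfl, fun C' _ => by simp [hg0, ← h0]⟩
    · obtain ⟨r, hr⟩ := h g.1 h2
      refine ⟨|r| / g.2, by positivity, fun C' hC' => ?_⟩
      have h4 : r ≤ C' * g.2 := (le_abs_self r).trans ((div_le_iff₀ hpos).1 hC')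
      convert add_mem hr (D.smul_mem (sub_nonneg.2 h4) hd) using 1
      module
  choose! C hC0 hC using hGC
  refine ⟨∑ g ∈ G, C g, Finset.sum_nonneg hC0, fun x hx => ?_⟩
  set C₀ := ∑ g ∈ G, C g
  have hle : P ≤ D.comap (fst + C₀ • snd.smulRight d) := by
    rw [← hG, Submodule.span_le]
    intro g hg
    have := hC g hg C₀ (Finset.single_le_sum hC0 hg)
    simpa [fst, snd, mul_smul] using this
  have hxP : (x, ‖x‖) ∈ P := (hP _).2 ⟨norm_nonneg x, hx, fun i => by
    simpa using abs_real_inner_le_norm (b i) x⟩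
  simpa [fst, snd, mul_smul] using hle hxP

theorem PointedCone.isCompact_orthogonalUnit {D : PointedCone ℝ E}
    (hD : IsClosed (D : Set E)) : IsCompact D.orthogonalUnit := by
  have : D.orthogonalUnit = Metric.sphere 0 1 ∩ ((D : Set E) ∩ (D.linealᗮ : Set E)) := by
    ext e
    simp only [PointedCone.orthogonalUnit, Set.mem_ofPred_eq, Set.mem_inter_iff,
      mem_sphere_zero_iff_norm, SetLike.mem_coe]
    tauto
  rw [this]
  exact (isCompact_sphere 0 1).inter_right (hD.inter (Submodule.closed_of_finiteDimensional _))

theorem PointedCone.exists_eq_add_smul_orthogonalUnit {D : PointedCone ℝ E} {x : E} (hx : x ∈ D)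
    (hxl : x ∉ D.lineal) :
    ∃ l ∈ D.lineal, ∃ r : ℝ, 0 < r ∧ ∃ e ∈ D.orthogonalUnit, x = l + r • e := by
  set l := D.lineal.starProjection x
  have hl : l ∈ D.lineal := Submodule.starProjection_apply_mem _ x
  have hne : x - l ≠ 0 := fun h => hxl (by rw [sub_eq_zero.1 h]; exact hl)
  have hpos : 0 < ‖x - l‖ := norm_pos_iff.2 hne
  refine ⟨l, hl, ‖x - l‖, hpos, ‖x - l‖⁻¹ • (x - l), ⟨?_, ?_, ?_⟩, ?_⟩
  · refine D.smul_mem (inv_nonneg.2 hpos.le) ?_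
    rw [sub_eq_add_neg]
    exact add_mem hx (PointedCone.mem_lineal.1 hl).2
  · exact Submodule.smul_mem _ _ (Submodule.sub_starProjection_mem_orthogonal x)
  · simp [norm_smul, hpos.ne']
  · rw [smul_smul, mul_inv_cancel₀ hpos.ne', one_smul, add_sub_cancel]

/-- If near each point of `D.orthogonalUnit` the closed cone `D` is cut out by finitely many
inequalities valid on `D`, then `D` is polyhedral. -/
theorem PointedCone.exists_finset_of_locally {D : PointedCone ℝ E} (hD : IsClosed (D : Set E))
    (hloc : ∀ d ∈ D.orthogonalUnit, ∃ (s : Finset E) (ε : ℝ), 0 < ε ∧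
      (∀ a ∈ s, ∀ x ∈ D, inner ℝ a x ≤ 0) ∧
      ∀ x, (∀ a ∈ s, inner ℝ a x ≤ 0) → dist x d < ε → x ∈ D) :
    ∃ s : Finset E, (D : Set E) = {u | ∀ a ∈ s, inner ℝ a u ≤ 0} := by
  classical
  rcases D.orthogonalUnit.eq_empty_or_nonempty with hempty | ⟨d₀, hd₀⟩
  · have : (D : Set E) = D.lineal := by
      refine Set.Subset.antisymm (fun x hx => ?_) (PointedCone.lineal_le D)
      by_contra hxl
      obtain ⟨-, -, -, -, e, he, -⟩ := exists_eq_add_smul_orthogonalUnit hx hxl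
      simp [hempty] at he
    rw [this]
    exact D.lineal.exists_finset_eq_inner_nonpos
  choose! s ε hε hs hsD using hloc
  have hlin : ∀ a, (∀ x ∈ D, inner ℝ a x ≤ 0) → ∀ l ∈ D.lineal, inner ℝ a l = 0 := by
    intro a ha l hl
    have h1 := ha l (PointedCone.mem_lineal.1 hl).1
    have h2 := ha (-l) (PointedCone.mem_lineal.1 hl).2
    rw [inner_neg_right] at h2
    linarith
  -- A half-space containing `D` with `d₀` in its interior keeps segments that start at `d₀` away
  -- from the lineality space, where no local description of `D` is available.
  obtain ⟨a₀, ha₀, ha₀d⟩ : ∃ a₀ : E, (∀ x ∈ D, inner ℝ a₀ x ≤ 0) ∧ inner ℝ a₀ d₀ < 0 := by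
    have hnot : -d₀ ∉ (D : Set E) := fun h =>
      notMem_lineal_of_mem_orthogonalUnit hd₀ (PointedCone.mem_lineal.2 ⟨hd₀.1, h⟩)
    obtain ⟨f, c, hf, hc⟩ := geometric_hahn_banach_closed_point D.convex hD hnot
    have hc0 : 0 < c := by simpa using hf 0 D.zero_mem
    refine ⟨(InnerProductSpace.toDual ℝ E).symm f, fun x hx => ?_, ?_⟩
    · rw [InnerProductSpace.toDual_symm_apply]
      by_contra! hpos
      have h1 := hf ((c / f x) • x) (D.smul_mem (by positivity) hx)
      rw [map_smul, smul_eq_mul, div_mul_cancel₀ _ hpos.ne'] at h1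
      exact lt_irrefl _ h1
    · rw [InnerProductSpace.toDual_symm_apply]
      rw [map_neg] at hc
      linarith
  obtain ⟨t, htS, ht⟩ := (isCompact_orthogonalUnit hD).elim_nhds_subcover
    (fun d => Metric.ball d (ε d)) (fun d hd => Metric.ball_mem_nhds d (hε d hd))
  refine ⟨insert a₀ (t.biUnion s), Set.Subset.antisymm (fun x hx a ha => ?_) fun x hx => ?_⟩
  · rcases Finset.mem_insert.1 ha with rfl | ha
    · exact ha₀ x hx
    · obtain ⟨d, hd, had⟩ := Finset.mem_biUnion.1 ha
      exact hs d (htS d hd) a had x hx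
  by_contra hxD
  have hxa₀ : inner ℝ a₀ x ≤ 0 := hx a₀ (Finset.mem_insert_self _ _)
  -- `y` is the last point of `D` on the segment from `d₀` to `x`.
  let Z : Set ℝ := Set.Icc 0 1 ∩ {τ | d₀ + τ • (x - d₀) ∈ D}
  have hZ : IsCompact Z := isCompact_Icc.inter_right
    (hD.preimage (f := fun τ : ℝ => d₀ + τ • (x - d₀)) (by fun_prop))
  have hZne : Z.Nonempty := ⟨0, ⟨le_rfl, zero_le_one⟩, by
    show d₀ + (0 : ℝ) • (x - d₀) ∈ D
    simpa using hd₀.1⟩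
  obtain ⟨τ, ⟨⟨hτ0, hτ1⟩, hτD⟩, hτmax⟩ := hZ.exists_isGreatest hZne
  have hτlt : τ < 1 := by
    refine lt_of_le_of_ne hτ1 ?_
    rintro rfl
    apply hxD
    have hτD' : d₀ + (1 : ℝ) • (x - d₀) ∈ D := hτD
    simpa using hτD'
  set y := d₀ + τ • (x - d₀) with hy
  have hyD : y ∈ D := hτD
  have hyl : y ∉ D.lineal := by
    intro h
    have h1 := hlin a₀ ha₀ y h
    rw [hy, inner_add_right, inner_smul_right, inner_sub_right] at h1
    nlinarith
  obtain ⟨l, hl, r, hr, e, he, hye⟩ := exists_eq_add_smul_orthogonalUnit hyD hyl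
  obtain ⟨d, hd, hed⟩ := Set.mem_iUnion₂.1 (ht he)
  have hcont : Tendsto (fun δ : ℝ => e + δ • (x - d₀)) (𝓝[>] 0) (𝓝 e) := by
    have : Tendsto (fun δ : ℝ => e + δ • (x - d₀)) (𝓝 0) (𝓝 (e + (0 : ℝ) • (x - d₀))) :=
      Continuous.tendsto (by fun_prop) 0
    rw [zero_smul, add_zero] at this
    exact this.mono_left nhdsWithin_le_nhds
  have hsmall : ∀ᶠ δ : ℝ in 𝓝[>] 0, r * δ < 1 - τ := by
    have : Tendsto (fun δ : ℝ => r * δ) (𝓝 0) (𝓝 (r * 0)) := Continuous.tendsto (by fun_prop) 0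
    rw [mul_zero] at this
    exact (this.mono_left nhdsWithin_le_nhds).eventually_lt_const (by linarith)
  obtain ⟨δ, ⟨hδ1, hδ2⟩, hδ0⟩ := ((hcont.eventually (Metric.isOpen_ball.mem_nhds hed)).and hsmall
    |>.and self_mem_nhdsWithin).exists
  have hδ0' : 0 < δ := hδ0
  have hmem : e + δ • (x - d₀) ∈ D := by
    refine hsD d (htS d hd) _ (fun a ha => ?_) hδ1
    have hax : inner ℝ a x ≤ 0 :=
      hx a (Finset.mem_insert_of_mem (Finset.mem_biUnion.2 ⟨d, hd, ha⟩))
    have had₀ : inner ℝ a d₀ ≤ 0 := hs d (htS d hd) a ha d₀ hd₀.1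
    have h1 : inner ℝ a y = r * inner ℝ a e := by
      rw [hye, inner_add_right, hlin a (hs d (htS d hd) a ha) l hl, zero_add, inner_smul_right]
    rw [hy, inner_add_right, inner_smul_right, inner_sub_right] at h1
    rw [inner_add_right, inner_smul_right, inner_sub_right]
    refine nonpos_of_mul_nonpos_right (a := r) ?_ hr
    have h2 : r * (inner ℝ a e + δ * (inner ℝ a x - inner ℝ a d₀))
        = (1 - τ - r * δ) * inner ℝ a d₀ + (τ + r * δ) * inner ℝ a x := by
      linear_combination -h1
    rw [h2]
    exact add_nonpos (mul_nonpos_of_nonneg_of_nonpos (by linarith) had₀)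
      (mul_nonpos_of_nonneg_of_nonpos (by positivity) hax)
  have hτ' : τ + r * δ ∈ Z := by
    refine ⟨⟨by positivity, by linarith⟩, ?_⟩
    show d₀ + (τ + r * δ) • (x - d₀) ∈ D
    have h1 : d₀ + (τ + r * δ) • (x - d₀) = l + r • (e + δ • (x - d₀)) := by
      rw [add_smul, ← add_assoc, ← hy, hye, smul_add, smul_smul, add_assoc]
    rw [h1]
    exact add_mem (PointedCone.mem_lineal.1 hl).1 (D.smul_mem hr.le hmem)
  have := hτmax hτ'
  nlinarith [mul_pos hr hδ0']

/-- A theorem of Mirkil and Klee: a convex cone whose sums with all linear subspaces are closed is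
polyhedral. By induction on the codimension of the lineality space, the tangent cones `D + ℝ d` are
polyhedral, and `D` agrees with such a tangent cone near `d`. -/
theorem PointedCone.exists_finset_of_isClosed_sup (D : PointedCone ℝ E)
    (hD : ∀ L : Submodule ℝ E, IsClosed ((D ⊔ (L : PointedCone ℝ E) : PointedCone ℝ E) : Set E)) :
    ∃ s : Finset E, (D : Set E) = {u | ∀ a ∈ s, inner ℝ a u ≤ 0} := by
  induction hk : Module.finrank ℝ E - Module.finrank ℝ D.lineal using Nat.strong_induction_on
    generalizing D with
  | _ k ih =>
  have hDc : IsClosed (D : Set E) := by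
    have := hD ⊥
    rwa [show D ⊔ PointedCone.ofSubmodule (⊥ : Submodule ℝ E) = D from
      sup_eq_left.2 fun x hx => by
        rw [PointedCone.mem_ofSubmodule_iff, Submodule.mem_bot] at hx
        rw [hx]; exact D.zero_mem] at this
  refine exists_finset_of_locally hDc fun d hd => ?_
  set T : PointedCone ℝ E := D ⊔ PointedCone.ofSubmodule (Submodule.span ℝ {d}) with hT
  have hdT : d ∈ T.lineal := PointedCone.mem_lineal.2
    ⟨(le_sup_right : _ ≤ T) (Submodule.mem_span_singleton_self d),
      (le_sup_right : _ ≤ T) (neg_mem (S := Submodule ℝ E) (Submodule.mem_span_singleton_self d))⟩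
  have hDT : D ≤ T := le_sup_left
  have hlt : D.lineal < T.lineal := by
    refine lt_of_le_of_ne (fun x hx => ⟨hDT hx.1, hDT hx.2⟩) fun h => ?_
    exact notMem_lineal_of_mem_orthogonalUnit hd (h ▸ hdT)
  have hfin := Submodule.finrank_lt_finrank_of_lt hlt
  have hfinE := Submodule.finrank_le T.lineal
  obtain ⟨s, hs⟩ := ih _ (by omega) T (fun L => by
    rw [hT, sup_assoc, ← PointedCone.ofSubmodule_sup]
    exact hD _) rfl
  have hmemT : ∀ x, x ∈ T ↔ ∀ a ∈ s, inner ℝ a x ≤ 0 := fun x => by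
    rw [← SetLike.mem_coe, hs]; rfl
  obtain ⟨C, hC0, hC⟩ := exists_forall_add_norm_smul_mem (D := D) hd.1 (s := s) fun x hx => by
    obtain ⟨y, hy, z, hz, rfl⟩ := Submodule.mem_sup.1 ((hmemT x).2 hx)
    obtain ⟨c, rfl⟩ := Submodule.mem_span_singleton.1 hz
    exact ⟨-c, by simpa [add_assoc] using hy⟩
  refine ⟨s, (C + 1)⁻¹, by positivity, fun a ha x hx => (hmemT x).1 (hDT hx) a ha,
    fun x hx hdist => ?_⟩
  have hxd : x - d ∈ T := by
    rw [sub_eq_add_neg]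
    exact add_mem ((hmemT x).2 hx) hdT.2
  have h1 := hC _ ((hmemT _).1 hxd)
  have h2 : C * ‖x - d‖ ≤ 1 := by
    rw [← dist_eq_norm]
    calc C * dist x d ≤ (C + 1) * (C + 1)⁻¹ := by gcongr; linarith
      _ = 1 := mul_inv_cancel₀ (by positivity)
  convert add_mem h1 (D.smul_mem (sub_nonneg.2 h2) hd.1) using 1
  module

end Mirkil

/-! ### The equivalence for Motzkin sets -/

theorem theorem4p1 (n : ℕ) (F K : Set (EuclideanSpace ℝ (Fin n)))
    (D : ConvexCone ℝ (EuclideanSpace ℝ (Fin n)))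
    (hF : F.Nonempty) (hK : IsCompact K)
    (hD : IsClosed (D : Set (EuclideanSpace ℝ (Fin n))))
    (hFKD : F = K + (D : Set (EuclideanSpace ℝ (Fin n)))) :
    recessionCone F = (D : Set (EuclideanSpace ℝ (Fin n))) ∧
    List.TFAE
      [IsFrankWolfeSet F,
       IsPolyhedralCone (recessionCone F),
       ¬ ∃ M : AffineSubspace ℝ (EuclideanSpace ℝ (Fin n)), IsFlatAsymptote M F] := by
  subst hFKD
  have hKne : K.Nonempty := hF.of_add_left
  have hDne : (D : Set (EuclideanSpace ℝ (Fin n))).Nonempty := hF.of_add_right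
  obtain ⟨C, rfl⟩ : ∃ C : PointedCone ℝ (EuclideanSpace ℝ (Fin n)), C.toConvexCone = D :=
    ⟨D.toPointedCone (ConvexCone.Pointed.of_nonempty_of_isClosed hDne hD), rfl⟩
  have hrec : recessionCone (K + (C.toConvexCone : Set (EuclideanSpace ℝ (Fin n)))) =
      (C : Set (EuclideanSpace ℝ (Fin n))) := recessionCone_add_eq hK hKne hD
  refine ⟨hrec, ?_⟩
  tfae_have 1 → 3 := fun h ⟨M, hM⟩ => h.not_isFlatAsymptote M hM
  tfae_have 3 → 2 := fun h => by
    rw [hrec]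
    refine C.exists_finset_of_isClosed_sup fun L => ?_
    exact isClosed_sup_of_not_isFlatAsymptote hK hKne (fun M hM => h ⟨M, hM⟩) L
  tfae_have 2 → 1 := fun h =>
    isFrankWolfeSet_add_of_isPolyhedralCone hK hKne (hrec ▸ h)
  tfae_finish
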